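/- For an integer $n\ge 1$ let $r_8(n)$ denote the number of $(x_1,\dots,x_8)\in\mathbb Z^8$ with $x_1^2+\cdots+x_8^2=n$, and for $a,q\in\mathbb C$ with $|q|<1$ let $(a;q)_\infty=\prod_{k=0}^{\infty}(1-aq^k)$. Then for every $n\ge 1$ $$(-1)^n r_8(n)=16\sum_{d\mid n}(-1)^d d^3 .$$ Moreover, for every real $q$ with $0<q<1$ and every complex $z$ with $\Re(z)>0$ (where $q^{w}=e^{w\log q}$ with the real logarithm $\log q$), the series below converge absolutely, the infinite products over $n$ converge unconditionally (in every order of the factors), and $$\prod_{n=1}^{\infty}\frac{\left(q^{(2n-1)z};q^{2n-1}\right)_{\infty}^{(2n-1)^{2}}}{\left(q^{2nz};q^{2n}\right)_{\infty}^{4n^{2}}}=\exp\left(\sum_{n=1}^{\infty}\frac{r_{8}(n)}{16\,n}\,\frac{(-1)^{n}q^{nz}}{1-q^{n}}\right)$$ and $$\prod_{n=1}^{\infty}\frac{\left(q^{2n(z+1)};q^{4n}\right)_{\infty}^{4n^{2}}\left(q^{(2n-1)z};q^{4n-2}\right)_{\infty}^{(2n-1)^{2}}}{\left(q^{2nz};q^{4n}\right)_{\infty}^{4n^{2}}\left(q^{(2n-1)(z+1)};q^{4n-2}\right)_{\infty}^{(2n-1)^{2}}}=\exp\left(\sum_{n=1}^{\infty}\frac{r_{8}(n)}{16\,n}\,\frac{(-1)^{n}q^{nz}}{1+q^{n}}\right).$$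 -/

import Mathlib

/-- The infinite `q`-shifted factorial `(a; q)_∞ = ∏_{k ≥ 0} (1 - a q^k)`, for `|q| < 1`. -/
noncomputable def qPochInf (a q : ℂ) : ℂ := ∏' k : ℕ, (1 - a * q ^ k)

/-- The product defining `(a; q)_∞` converges for every `a` when `|q| < 1`. -/
theorem hasProd_qPochInf (a : ℂ) {q : ℂ} (hq : ‖q‖ < 1) :
    HasProd (fun k : ℕ => 1 - a * q ^ k) (qPochInf a q) := by
  have h : Multipliable (fun k : ℕ => 1 + (-(a * q ^ k))) := by
    apply multipliable_one_add_of_summable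
    simp only [norm_neg, norm_mul, norm_pow]
    exact (summable_geometric_of_lt_one (norm_nonneg q) hq).mul_left _
  simpa only [qPochInf, sub_eq_add_neg] using h.hasProd

/-- The representations of `n` as an ordered sum of `k` squares of integers. -/
def squareReps (k n : ℕ) : Set (Fin k → ℤ) := {x | ∑ i, x i ^ 2 = (n : ℤ)}

/-- There are only finitely many representations, so counting them is meaningful. -/
theorem squareReps_finite (k n : ℕ) : (squareReps k n).Finite := by
  refine (Set.finite_Icc (fun _ : Fin k => -(n : ℤ)) (fun _ => (n : ℤ))).subset ?_
  intro x hx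
  have hle : ∀ i, x i ^ 2 ≤ (n : ℤ) := fun i => by
    have h := Finset.single_le_sum (f := fun i => x i ^ 2)
      (fun j _ => sq_nonneg (x j)) (Finset.mem_univ i)
    exact h.trans (le_of_eq hx)
  refine ⟨fun i => ?_, fun i => ?_⟩
  · have := hle i
    show -(n : ℤ) ≤ x i
    nlinarith [sq_nonneg (x i + 1)]
  · have := hle i
    show x i ≤ (n : ℤ)
    nlinarith [sq_nonneg (x i - 1)]

/-- `r_k(n)`: the number of representations of `n` as a sum of `k` squares of integers, where
order and signs are taken into account. -/
noncomputable def sumSqCount (k n : ℕ) : ℕ := (squareReps k n).ncard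

/-!
The analytic content is Jacobi's eight squares theorem; the product formulas follow from it by
rearranging an absolutely convergent triple series.

For the eight squares theorem, let `θ` be the Jacobi theta function, so that the representation
numbers are the coefficients of `θ ^ 8` in powers of `exp (π i w)`. The function
`E₄ (w / 2) - 2 E₄ w + 16 E₄ (2 w)` has the same weight four behaviour as `15 θ ^ 8` under
`w ↦ w + 2` and `w ↦ -1 / w`, which generate the theta group, a subgroup of index three in the
modular group. Let `Φ` be the difference of the two (`thetaEightDefect`) and `Ψ` the transform of
`Φ` by `w ↦ 1 - 1 / w`, which takes `i∞` to the other cusp. Then `Φ w * Φ (w + 1) * Ψ w` is modular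
of weight twelve for the full modular group. As `Φ` has no terms of degree zero or one in
`exp (π i w)` and `Ψ` is bounded near `i∞`, this product is `O (exp (-4 π Im w))`. It is
therefore a cusp form, hence a multiple of the discriminant, which only decays like
`exp (-2 π Im w)`; so the product is zero (`eq_zero_of_weight_twelve_of_decay`), and by the identity
theorem one of its factors, and then `Φ`, is zero (`thetaEightDefect_eq_zero`). Comparing
coefficients gives `r₈ n = 16 (σ₃ n - 2 σ₃ (n / 2) + 16 σ₃ (n / 4))`, where terms with a
non-integral argument are zero, and this is the signed divisor sum
(`neg_one_pow_mul_sumSqCount_eight`).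

For the products, put `x = q ^ z` and consider, for `s = 1` and `s = -1`, the series over `m`, `d`
and `k` with terms `(-1) ^ d * d ^ 2 * (x ^ d * q ^ (d * k)) ^ m / m * s ^ k`. Summing the geometric
series over `k` and collecting the terms with `d * m = n` gives the Lambert series in the exponent
(`hasSum_lambert`, `hasSum_sumSqCount_lambert`). Summing over `m` gives logarithms of the factors of
`(x ^ d; q ^ d)_∞` (`hasSum_log_lambert`), and exponentiating gives the infinite products.
-/

/-! ### Theta series and sums of squares -/

/-- The theta series of the lattice `ℤ^k`: grouping the terms of `(∑ q^(m^2))^k` by the value of the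
quadratic form gives the representation numbers as coefficients. -/
theorem hasSum_sumSqCount_mul_pow (k : ℕ) {q : ℂ} {θ : ℂ}
    (hs : HasSum (fun m : ℤ => q ^ (m ^ 2).toNat) θ)
    (hn : Summable fun m : ℤ => ‖q ^ (m ^ 2).toNat‖) :
    HasSum (fun n : ℕ => (sumSqCount k n : ℂ) * q ^ n) (θ ^ k) := by
  have key : ∀ k : ℕ, HasSum (fun x : Fin k → ℤ => q ^ (∑ i, x i ^ 2).toNat) (θ ^ k) ∧
      Summable (fun x : Fin k → ℤ => ‖q ^ (∑ i, x i ^ 2).toNat‖) := by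
    intro k
    induction k with
    | zero =>
      refine ⟨?_, ?_⟩
      · simp
      · exact Summable.of_finite
    | succ k ih =>
      obtain ⟨h1, h2⟩ := ih
      have hterm : ∀ p : ℤ × (Fin k → ℤ),
          q ^ (∑ i, (Fin.consEquiv (fun _ : Fin (k + 1) => ℤ) p) i ^ 2).toNat =
            q ^ (p.1 ^ 2).toNat * q ^ (∑ i, p.2 i ^ 2).toNat := by
        intro p
        rw [← pow_add, ← Int.toNat_add (sq_nonneg _) (Finset.sum_nonneg fun i _ => sq_nonneg _)]
        simp [Fin.consEquiv, Fin.sum_univ_succ]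
      have hm : Summable fun p : ℤ × (Fin k → ℤ) =>
          ‖q ^ (p.1 ^ 2).toNat * q ^ (∑ i, p.2 i ^ 2).toNat‖ :=
        Summable.mul_norm (f := fun m : ℤ => q ^ (m ^ 2).toNat)
          (g := fun x : Fin k → ℤ => q ^ (∑ i, x i ^ 2).toNat) hn h2
      refine ⟨?_, ?_⟩
      · rw [← (Fin.consEquiv (fun _ : Fin (k + 1) => ℤ)).hasSum_iff, pow_succ']
        refine (hs.mul h1 hm.of_norm).congr_fun ?_
        exact fun p => hterm p
      · rw [← (Fin.consEquiv (fun _ : Fin (k + 1) => ℤ)).summable_iff]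
        refine hm.congr fun p => ?_
        rw [Function.comp_apply, hterm p]
  have h := (key k).1
  rw [← (Equiv.sigmaFiberEquiv fun x : Fin k → ℤ => (∑ i, x i ^ 2).toNat).hasSum_iff] at h
  refine h.sigma fun n => ?_
  have hset : {x : Fin k → ℤ | (∑ i, x i ^ 2).toNat = n} = squareReps k n := by
    ext x
    have : 0 ≤ ∑ i, x i ^ 2 := Finset.sum_nonneg fun i _ => sq_nonneg _
    simp only [squareReps, Set.mem_ofPred_eq]
    omega
  have hfin : Finite {x : Fin k → ℤ // (∑ i, x i ^ 2).toNat = n} := by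
    have := (squareReps_finite k n).to_subtype
    rw [← hset] at this
    exact this
  have := Fintype.ofFinite {x : Fin k → ℤ // (∑ i, x i ^ 2).toNat = n}
  have hc : (sumSqCount k n : ℂ) * q ^ n =
      ∑ x : {x : Fin k → ℤ // (∑ i, x i ^ 2).toNat = n}, q ^ (∑ i, x.1 i ^ 2).toNat := by
    rw [Finset.sum_congr rfl (fun x _ => by rw [x.2]), Finset.sum_const, nsmul_eq_mul]
    congr 2
    rw [sumSqCount, ← hset, Finset.card_univ, ← Nat.card_eq_fintype_card]
    rfl
  rw [hc]
  exact hasSum_fintype _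

theorem sumSqCount_zero_right (k : ℕ) : sumSqCount k 0 = 1 := by
  have : squareReps k 0 = {0} := by
    ext x
    simp only [squareReps, Set.mem_ofPred_eq, Set.mem_singleton_iff, Nat.cast_zero]
    rw [Finset.sum_eq_zero_iff_of_nonneg fun i _ => sq_nonneg _]
    simp [funext_iff]
  rw [sumSqCount, this, Set.ncard_singleton]

theorem sumSqCount_eight_one : sumSqCount 8 1 = 16 := by
  have : squareReps 8 1 =
      Set.range fun p : Fin 8 × Bool => (Pi.single p.1 (if p.2 then 1 else -1) : Fin 8 → ℤ) := by
    ext x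
    simp only [squareReps, Set.mem_ofPred_eq, Set.mem_range, Prod.exists, Nat.cast_one]
    constructor
    · intro h
      obtain ⟨i, hi⟩ : ∃ i, x i ≠ 0 := by
        by_contra! h0
        simp [h0] at h
      have h1 : 1 ≤ x i ^ 2 := by
        have := pow_pos (abs_pos.mpr hi) 2
        rw [sq_abs] at this
        omega
      rw [← Finset.add_sum_erase _ _ (Finset.mem_univ i)] at h
      have h2 : 0 ≤ ∑ j ∈ Finset.univ.erase i, x j ^ 2 :=
        Finset.sum_nonneg fun i _ => sq_nonneg _
      have h3 : ∑ j ∈ Finset.univ.erase i, x j ^ 2 = 0 := by omega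
      rw [Finset.sum_eq_zero_iff_of_nonneg fun i _ => sq_nonneg _] at h3
      have hx : x = Pi.single i (x i) := by
        ext j
        rcases eq_or_ne j i with rfl | hj
        · simp
        · rw [Pi.single_eq_of_ne hj]
          exact pow_eq_zero_iff two_ne_zero |>.mp (h3 j (by simp [hj]))
      have h4 : x i ^ 2 = 1 := by omega
      rcases (by simpa using h4 : x i = 1 ∨ x i = -1) with h5 | h5
      · exact ⟨i, true, by rw [hx, h5]; simp⟩
      · exact ⟨i, false, by rw [hx, h5]; simp⟩
    · rintro ⟨i, b, rfl⟩
      rw [← Finset.add_sum_erase _ _ (Finset.mem_univ i), Finset.sum_eq_zero]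
      · cases b <;> simp
      · intro j hj
        rw [Pi.single_eq_of_ne (Finset.ne_of_mem_erase hj)]
        simp
  rw [sumSqCount, this, ← Set.image_univ, Set.ncard_image_of_injective _ (by decide),
    Set.ncard_univ]
  simp

/-- Substituting `q ^ k` for the variable spreads the coefficients of a power series out to the
multiples of `k`. -/
theorem HasSum.spread_pow {a : ℕ → ℂ} {q s : ℂ} {k : ℕ} (hk : 0 < k)
    (h : HasSum (fun m => a m * (q ^ k) ^ m) s) :
    HasSum (fun n => (if k ∣ n then a (n / k) else 0) * q ^ n) s := by
  have hinj : Function.Injective fun m : ℕ => k * m := fun _ _ h => Nat.eq_of_mul_eq_mul_left hk h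
  rw [← hinj.hasSum_iff]
  · refine h.congr_fun fun m => ?_
    simp [Nat.mul_div_cancel_left _ hk, pow_mul]
  · rintro n hn
    rw [if_neg, zero_mul]
    rintro ⟨m, rfl⟩
    exact hn ⟨m, rfl⟩

/-! ### A vanishing criterion in level one and weight twelve -/

/-- A power series whose coefficients vanish below `k` is `O(q ^ k)`, with an explicit constant. -/
theorem HasSum.norm_le_pow_mul {c : ℕ → ℂ} {q s : ℂ} {r : ℝ} {k : ℕ} (hr : 0 < r) (hq : ‖q‖ ≤ r)
    (hc : ∀ n < k, c n = 0) (hsum : Summable fun n => ‖c n‖ * r ^ n)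
    (h : HasSum (fun n => c n * q ^ n) s) :
    ‖s‖ ≤ (∑' n, ‖c n‖ * r ^ n) / r ^ k * ‖q‖ ^ k := by
  have hle : ∀ n, ‖c n * q ^ n‖ ≤ ‖c n‖ * r ^ n * (‖q‖ ^ k / r ^ k) := by
    intro n
    rcases lt_or_ge n k with hn | hn
    · simp [hc n hn]
    · obtain ⟨m, rfl⟩ := Nat.exists_eq_add_of_le hn
      rw [norm_mul, norm_pow, mul_assoc]
      gcongr
      rw [pow_add, pow_add]
      have : ‖q‖ ^ m ≤ r ^ m := by gcongr
      calc ‖q‖ ^ k * ‖q‖ ^ m ≤ ‖q‖ ^ k * r ^ m := by gcongr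
        _ = r ^ k * r ^ m * (‖q‖ ^ k / r ^ k) := by field_simp
  have h2 := hsum.mul_right (‖q‖ ^ k / r ^ k)
  have h3 := tsum_of_norm_bounded h2.hasSum hle
  rw [h.tsum_eq, tsum_mul_right] at h3
  exact h3.trans_eq (by ring)

open UpperHalfPlane ModularForm Filter in
/-- A holomorphic function on the upper half plane that transforms like a modular form of level one
and weight twelve vanishes if it decays faster than the discriminant: it is a cusp form, hence a
multiple of the discriminant. -/
theorem eq_zero_of_weight_twelve_of_decay {F : ℂ → ℂ} (hd : DifferentiableOn ℂ F {w | 0 < w.im})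
    (hT : ∀ w : ℂ, 0 < w.im → F (w + 1) = F w)
    (hS : ∀ w : ℂ, 0 < w.im → F (-1 / w) = w ^ 12 * F w) {C : ℝ}
    (hB : ∀ w : ℂ, 1 ≤ w.im → ‖F w‖ ≤ C * Real.exp (-4 * Real.pi * w.im))
    {w : ℂ} (hw : 0 < w.im) : F w = 0 := by
  let f : ℍ → ℂ := fun τ => F τ
  have hfS : f ∣[(12 : ℤ)] ModularGroup.S = f := by
    ext τ
    rw [SlashInvariantForm.slash_S_apply]
    have h0 : (τ : ℂ) ≠ 0 := τ.ne_zero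
    have : (-(τ : ℂ))⁻¹ = -1 / (τ : ℂ) := by rw [neg_div, one_div, inv_neg]
    simp only [f, this, hS τ τ.im_pos]
    rw [zpow_neg]
    norm_cast
    field_simp
  have hfT : f ∣[(12 : ℤ)] ModularGroup.T = f := by
    ext τ
    have h1 : (1 : ℂ) + τ = τ + 1 := add_comm _ _
    rw [SL_slash_apply, ModularGroup.denom_apply, modular_T_smul]
    simp [f, h1, hT τ τ.im_pos, ModularGroup.T]
  have hfSL := SlashInvariantForm.slash_action_generators_SL2Z hfS hfT
  have hO : f =O[atImInfty] fun τ : ℍ => Real.exp (-4 * Real.pi * τ.im) := by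
    refine Asymptotics.IsBigO.of_bound C ?_
    rw [Filter.Eventually, atImInfty_mem]
    refine ⟨1, fun τ hτ => ?_⟩
    simpa [abs_of_pos (Real.exp_pos _)] using hB τ hτ
  have hexp : Tendsto (fun τ : ℍ => Real.exp (-2 * Real.pi * τ.im)) atImInfty (nhds 0) := by
    refine Real.tendsto_exp_atBot.comp ?_
    exact tendsto_comap.const_mul_atTop_of_neg (by linarith [Real.pi_pos])
  have hexp4 : Tendsto (fun τ : ℍ => Real.exp (-4 * Real.pi * τ.im)) atImInfty (nhds 0) := by
    refine Real.tendsto_exp_atBot.comp ?_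
    exact tendsto_comap.const_mul_atTop_of_neg (by linarith [Real.pi_pos])
  have hzero : IsZeroAtImInfty f := hO.trans_tendsto hexp4
  let g : CuspForm (Matrix.SpecialLinearGroup.mapGL ℝ).range 12 :=
    { toFun := f
      slash_action_eq' := by
        rintro A ⟨A, rfl⟩
        exact hfSL A
      holo' := by
        rw [UpperHalfPlane.mdifferentiable_iff]
        refine hd.congr fun z hz => ?_
        simp [f, ofComplex_apply_of_im_pos hz]
      zero_at_cusps' := by
        intro c hc
        rw [Subgroup.IsArithmetic.isCusp_iff_isCusp_SL2Z] at hc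
        rw [OnePoint.isZeroAt_iff_forall_SL2Z hc]
        intro γ _
        exact (hfSL γ).symm ▸ hzero }
  obtain ⟨c, hc⟩ := CuspForm.exists_smul_discriminant_of_weight_eq_twelve g
  have hfc : ∀ τ : ℍ, f τ = c * ModularForm.discriminant τ := fun τ =>
    (DFunLike.congr_fun hc τ).symm
  by_cases hc0 : c = 0
  · have := hfc ⟨w, hw⟩
    simpa [f, hc0] using this
  -- `exp (-2πy) = O(Δ) = O(f) = O(exp (-4πy))` is absurd as `y → ∞`.
  exfalso
  have h1 : ModularForm.discriminant =O[atImInfty] f := by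
    refine Asymptotics.IsBigO.of_bound ‖c‖⁻¹ (Eventually.of_forall fun τ => ?_)
    rw [hfc, norm_mul, inv_mul_cancel_left₀ (norm_ne_zero_iff.mpr hc0)]
  have h2 := (exp_isBigO_discriminant.trans h1).trans hO
  have h3 : (fun _ : ℍ => (1 : ℝ)) =O[atImInfty]
      fun τ : ℍ => Real.exp (-2 * Real.pi * τ.im) := by
    have := h2.mul (Asymptotics.isBigO_refl
      (fun τ : ℍ => Real.exp (2 * Real.pi * τ.im)) atImInfty)
    refine (this.congr_left fun τ => ?_).congr_right fun τ => ?_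
    · rw [← Real.exp_add]; simp
    · rw [← Real.exp_add]; ring_nf
  have h4 := h3.trans_tendsto hexp
  exact one_ne_zero (tendsto_nhds_unique tendsto_const_nhds h4)

/-! ### The Eisenstein series of weight four -/

/-- The normalised Eisenstein series `E₄` as a function of a complex variable, to be used on the
upper half plane only. -/
noncomputable def eisFour (w : ℂ) : ℂ := ModularForm.E₄ (UpperHalfPlane.ofComplex w)

/-- The Fourier coefficients of `E₄`. -/
noncomputable def eisFourCoeff (n : ℕ) : ℂ :=
  if n = 0 then 1 else 240 * (ArithmeticFunction.sigma 3 n : ℂ)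

theorem eisFour_add_one (w : ℂ) : eisFour (w + 1) = eisFour w := by
  have := SlashInvariantFormClass.periodic_comp_ofComplex (h := 1) ModularForm.E₄
    one_mem_strictPeriods_SL w
  simpa [eisFour] using this

open UpperHalfPlane ModularForm in
theorem eisFour_neg_one_div {w : ℂ} (hw : 0 < w.im) : eisFour (-1 / w) = w ^ 4 * eisFour w := by
  have h1 : (⇑ModularForm.E₄ : ℍ → ℂ) ∣[(4 : ℤ)] ModularGroup.S = ⇑ModularForm.E₄ :=
    SlashInvariantFormClass.slash_action_eq ModularForm.E₄ _ ⟨ModularGroup.S, rfl⟩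
  have h2 := congr_fun h1 ⟨w, hw⟩
  rw [SlashInvariantForm.slash_S_apply] at h2
  have hw0 : w ≠ 0 := by rintro rfl; simp at hw
  have h3 : (-w)⁻¹ = -1 / w := by rw [neg_div, one_div, inv_neg]
  have h4 : 0 < (-1 / w).im := h3 ▸ (⟨w, hw⟩ : ℍ).im_inv_neg_coe_pos
  rw [eisFour, eisFour, ofComplex_apply_of_im_pos h4, ofComplex_apply_of_im_pos hw, ← h2]
  simp only [h3]
  rw [zpow_neg]
  norm_cast
  field_simp

theorem differentiableOn_eisFour : DifferentiableOn ℂ eisFour {w | 0 < w.im} :=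
  UpperHalfPlane.mdifferentiable_iff.mp ModularForm.E₄.holo'

open UpperHalfPlane in
theorem hasSum_eisFour {w : ℂ} (hw : 0 < w.im) :
    HasSum (fun n => eisFourCoeff n * Complex.exp (2 * Real.pi * Complex.I * w) ^ n)
      (eisFour w) := by
  have := ModularForm.hasSum_qExpansion (h := 1) ModularForm.E₄ one_pos
    one_mem_strictPeriods_SL ⟨w, hw⟩
  rw [eisFour, ofComplex_apply_of_im_pos hw]
  refine this.congr_fun fun n => ?_
  rw [EisensteinSeries.E_qExpansion_coeff _ ⟨2, rfl⟩]
  have hb : (bernoulli 4 : ℂ) = -1 / 30 := by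
    rw [show bernoulli 4 = -1 / 30 by decide +kernel]; norm_num
  simp only [eisFourCoeff, Function.Periodic.qParam]
  push_cast
  rw [hb]
  norm_num

/-! ### The eighth power of the theta function -/

/-- The difference between fifteen times `θ ^ 8` and the Eisenstein series of weight four on the
theta group. It transforms like a modular form of weight four on that group, and the theorem on
eight squares says that it vanishes. -/
noncomputable def thetaEightDefect (w : ℂ) : ℂ :=
  eisFour (w / 2) - 2 * eisFour w + 16 * eisFour (2 * w) - 15 * jacobiTheta w ^ 8

/-- The coefficients of `thetaEightDefect` as a power series in `exp (π i w)`. -/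
noncomputable def thetaEightDefectCoeff (n : ℕ) : ℂ :=
  eisFourCoeff n - 2 * (if 2 ∣ n then eisFourCoeff (n / 2) else 0) +
    16 * (if 4 ∣ n then eisFourCoeff (n / 4) else 0) - 15 * sumSqCount 8 n

theorem hasSum_jacobiTheta_eight {w : ℂ} (hw : 0 < w.im) :
    HasSum (fun n : ℕ => (sumSqCount 8 n : ℂ) * Complex.exp (Real.pi * Complex.I * w) ^ n)
      (jacobiTheta w ^ 8) := by
  have hterm : ∀ m : ℤ, jacobiTheta₂_term m 0 w =
      Complex.exp (Real.pi * Complex.I * w) ^ (m ^ 2).toNat := by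
    intro m
    rw [jacobiTheta₂_term, ← Complex.exp_nat_mul]
    congr 1
    have : (((m ^ 2).toNat : ℕ) : ℂ) = (m : ℂ) ^ 2 := by
      rw [← Int.cast_natCast, Int.toNat_of_nonneg (sq_nonneg m)]
      push_cast
      rfl
    rw [this]
    ring
  have h := hasSum_jacobiTheta₂_term 0 hw
  rw [← jacobiTheta_eq_jacobiTheta₂] at h
  simp only [hterm] at h
  exact hasSum_sumSqCount_mul_pow 8 h h.summable.norm

theorem hasSum_thetaEightDefect {w : ℂ} (hw : 0 < w.im) :
    HasSum (fun n : ℕ => thetaEightDefectCoeff n * Complex.exp (Real.pi * Complex.I * w) ^ n)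
      (thetaEightDefect w) := by
  have h1 : HasSum (fun n => eisFourCoeff n * Complex.exp (Real.pi * Complex.I * w) ^ n)
      (eisFour (w / 2)) := by
    have := hasSum_eisFour (w := w / 2) (by simpa using hw)
    rwa [show 2 * Real.pi * Complex.I * (w / 2) = Real.pi * Complex.I * w by ring] at this
  have h2 := HasSum.spread_pow (q := Complex.exp (Real.pi * Complex.I * w)) (k := 2) two_pos
    (by
      have := hasSum_eisFour hw
      rwa [show 2 * Real.pi * Complex.I * w = (2 : ℕ) * (Real.pi * Complex.I * w) by
        push_cast; ring, Complex.exp_nat_mul] at this)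
  have h4 := HasSum.spread_pow (q := Complex.exp (Real.pi * Complex.I * w)) (k := 4) four_pos
    (by
      have := hasSum_eisFour (w := 2 * w) (by simpa using hw)
      rwa [show 2 * Real.pi * Complex.I * (2 * w) = (4 : ℕ) * (Real.pi * Complex.I * w) by
        push_cast; ring, Complex.exp_nat_mul] at this)
  refine (((h1.sub (h2.mul_left 2)).add (h4.mul_left 16)).sub
    ((hasSum_jacobiTheta_eight hw).mul_left 15)).congr_fun fun n => ?_
  rw [thetaEightDefectCoeff]
  ring

/-- The first two coefficients vanish since `15 r₈ 0 = 1 - 2 + 16` and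
`15 r₈ 1 = 240`. -/
theorem thetaEightDefectCoeff_eq_zero_of_lt_two {n : ℕ} (hn : n < 2) :
    thetaEightDefectCoeff n = 0 := by
  interval_cases n
  · simp [thetaEightDefectCoeff, eisFourCoeff, sumSqCount_zero_right]
    norm_num
  · simp [thetaEightDefectCoeff, eisFourCoeff, sumSqCount_eight_one]
    norm_num

theorem norm_exp_pi_mul_I_mul (w : ℂ) :
    ‖Complex.exp (Real.pi * Complex.I * w)‖ = Real.exp (-Real.pi * w.im) := by
  rw [Complex.norm_exp]
  congr 1
  simp

theorem norm_exp_two_pi_mul_I_mul (w : ℂ) :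
    ‖Complex.exp (2 * Real.pi * Complex.I * w)‖ = Real.exp (-2 * Real.pi * w.im) := by
  rw [Complex.norm_exp]
  congr 1
  simp

theorem exists_norm_thetaEightDefect_le : ∃ C : ℝ, ∀ w : ℂ, 1 ≤ w.im →
    ‖thetaEightDefect w‖ ≤ C * Real.exp (-2 * Real.pi * w.im) := by
  have hs := (hasSum_thetaEightDefect (w := Complex.I) (by simp)).summable.norm
  simp only [norm_mul, norm_pow, norm_exp_pi_mul_I_mul, Complex.I_im, mul_one] at hs
  refine ⟨(∑' n, ‖thetaEightDefectCoeff n‖ * Real.exp (-Real.pi) ^ n) /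
    Real.exp (-Real.pi) ^ 2, fun w hw => ?_⟩
  have h := (hasSum_thetaEightDefect (w := w) (by linarith)).norm_le_pow_mul (k := 2)
    (r := Real.exp (-Real.pi)) (Real.exp_pos _)
    (by
      rw [norm_exp_pi_mul_I_mul]
      gcongr
      nlinarith [Real.pi_pos])
    (fun n hn => thetaEightDefectCoeff_eq_zero_of_lt_two hn) hs
  rw [norm_exp_pi_mul_I_mul, ← Real.exp_nat_mul (-Real.pi * w.im)] at h
  convert h using 3
  push_cast
  ring

theorem exists_norm_eisFour_le : ∃ C : ℝ, ∀ w : ℂ, 1 / 2 ≤ w.im → ‖eisFour w‖ ≤ C := by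
  have hs := (hasSum_eisFour (w := Complex.I / 2) (by simp)).summable.norm
  simp only [norm_mul, norm_pow, norm_exp_two_pi_mul_I_mul] at hs
  have h12 : (Complex.I / 2).im = 1 / 2 := by simp
  rw [h12] at hs
  refine ⟨(∑' n, ‖eisFourCoeff n‖ * Real.exp (-2 * Real.pi * (1 / 2)) ^ n), fun w hw => ?_⟩
  have h := (hasSum_eisFour (w := w) (by linarith)).norm_le_pow_mul (k := 0)
    (r := Real.exp (-2 * Real.pi * (1 / 2))) (Real.exp_pos _)
    (by
      rw [norm_exp_two_pi_mul_I_mul]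
      exact Real.exp_le_exp.mpr (by nlinarith [Real.pi_pos]))
    (fun n hn => absurd hn n.not_lt_zero) hs
  simpa using h

theorem thetaEightDefect_add_two (w : ℂ) : thetaEightDefect (w + 2) = thetaEightDefect w := by
  have h1 : eisFour ((w + 2) / 2) = eisFour (w / 2) := by
    rw [show (w + 2) / 2 = w / 2 + 1 by ring, eisFour_add_one]
  have h2 : eisFour (w + 2) = eisFour w := by
    rw [show w + 2 = w + 1 + 1 by ring, eisFour_add_one, eisFour_add_one]
  have h3 : eisFour (2 * (w + 2)) = eisFour (2 * w) := by
    rw [show 2 * (w + 2) = 2 * w + 1 + 1 + 1 + 1 by ring, eisFour_add_one,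
      eisFour_add_one, eisFour_add_one, eisFour_add_one]
  have h4 : jacobiTheta (w + 2) = jacobiTheta w := by rw [add_comm, jacobiTheta_two_add]
  rw [thetaEightDefect, thetaEightDefect, h1, h2, h3, h4]

theorem neg_I_mul_cpow_half_pow_eight (w : ℂ) :
    ((-Complex.I * w) ^ (1 / 2 : ℂ)) ^ 8 = w ^ 4 := by
  rw [← Complex.cpow_nat_mul]
  have : ((8 : ℕ) : ℂ) * (1 / 2 : ℂ) = ((4 : ℕ) : ℂ) := by norm_num
  rw [this, Complex.cpow_natCast, mul_pow, Even.neg_pow ⟨2, rfl⟩, Complex.I_pow_four, one_mul]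

theorem jacobiTheta_neg_one_div_pow_eight {w : ℂ} (hw : 0 < w.im) :
    jacobiTheta (-1 / w) ^ 8 = w ^ 4 * jacobiTheta w ^ 8 := by
  have h := jacobiTheta_S_smul ⟨w, hw⟩
  rw [UpperHalfPlane.modular_S_smul] at h
  have h3 : (-w)⁻¹ = -1 / w := by rw [neg_div, one_div, inv_neg]
  simp only [h3] at h
  rw [h, mul_pow, neg_I_mul_cpow_half_pow_eight w]

theorem im_neg_one_div_pos {w : ℂ} (hw : 0 < w.im) : 0 < (-1 / w).im := by
  have := (⟨w, hw⟩ : UpperHalfPlane).im_inv_neg_coe_pos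
  rwa [show (-1 / w) = (-w)⁻¹ by rw [neg_div, one_div, inv_neg]]

theorem thetaEightDefect_neg_one_div {w : ℂ} (hw : 0 < w.im) :
    thetaEightDefect (-1 / w) = w ^ 4 * thetaEightDefect w := by
  have hw0 : w ≠ 0 := by rintro rfl; simp at hw
  have h1 : eisFour (-1 / w / 2) = 16 * w ^ 4 * eisFour (2 * w) := by
    rw [show -1 / w / 2 = -1 / (2 * w) by field_simp, eisFour_neg_one_div (by simpa using hw)]
    ring
  have h2 : eisFour (2 * (-1 / w)) = w ^ 4 / 16 * eisFour (w / 2) := by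
    rw [show 2 * (-1 / w) = -1 / (w / 2) by field_simp, eisFour_neg_one_div (by simpa using hw)]
    ring
  rw [thetaEightDefect, thetaEightDefect, h1, h2, eisFour_neg_one_div hw,
    jacobiTheta_neg_one_div_pow_eight hw]
  ring

theorem differentiableOn_thetaEightDefect :
    DifferentiableOn ℂ thetaEightDefect {w | 0 < w.im} := by
  have h1 : DifferentiableOn ℂ (fun w : ℂ => eisFour (w / 2)) {w | 0 < w.im} :=
    differentiableOn_eisFour.comp (by fun_prop) fun w hw => by simpa using hw
  have h2 : DifferentiableOn ℂ (fun w : ℂ => eisFour (2 * w)) {w | 0 < w.im} :=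
    differentiableOn_eisFour.comp (by fun_prop) fun w hw => by simpa using hw
  have h3 : DifferentiableOn ℂ jacobiTheta {w | 0 < w.im} := fun w hw =>
    (differentiableAt_jacobiTheta hw).differentiableWithinAt
  exact ((h1.sub (differentiableOn_eisFour.const_mul 2)).add (h2.const_mul 16)).sub
    ((h3.pow 8).const_mul 15)

/-- The translate by one of `θ` is the theta function with characteristic `1 / 2`. -/
theorem jacobiTheta_one_add (w : ℂ) : jacobiTheta (1 + w) = jacobiTheta₂ (1 / 2) w := by
  rw [jacobiTheta_eq_jacobiTheta₂, jacobiTheta₂, jacobiTheta₂]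
  refine tsum_congr fun n => ?_
  rw [jacobiTheta₂_term, jacobiTheta₂_term, Complex.exp_eq_exp_iff_exists_int]
  -- The exponents differ by a multiple of `2 π i` because `n ^ 2 - n` is even.
  obtain ⟨m, hm⟩ := Int.even_mul_succ_self (n - 1)
  refine ⟨m, ?_⟩
  have hm' : ((n : ℂ) - 1) * n = m + m := by
    have : (n - 1) * n = m + m := by rw [← hm]; ring
    exact_mod_cast this
  linear_combination (Real.pi * Complex.I) * hm'

/-- The behaviour of `θ ^ 8` at the cusp of the theta group other than `i∞`. -/
theorem jacobiTheta_one_sub_one_div_pow_eight {w : ℂ} (hw : 0 < w.im) :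
    jacobiTheta (1 + -1 / w) ^ 8 =
      w ^ 4 * (Complex.exp (2 * Real.pi * Complex.I * w) * jacobiTheta₂ (w / 2) w ^ 8) := by
  have hw0 : w ≠ 0 := by rintro rfl; simp at hw
  have h := jacobiTheta₂_functional_equation (w / 2) w
  rw [show w / 2 / w = 1 / 2 by field_simp] at h
  rw [jacobiTheta_one_add, h, mul_pow, mul_pow, div_pow, neg_I_mul_cpow_half_pow_eight w,
    ← Complex.exp_nat_mul]
  have : Complex.exp (2 * Real.pi * Complex.I * w) *
      Complex.exp ((8 : ℕ) * (-Real.pi * Complex.I * (w / 2) ^ 2 / w)) = 1 := by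
    rw [← Complex.exp_add, Complex.exp_eq_one_iff]
    refine ⟨0, ?_⟩
    push_cast
    field_simp
    ring
  have h4 : w ^ 4 * (1 ^ 8 / w ^ 4) = 1 := by field_simp
  linear_combination (-(w ^ 4 * (1 ^ 8 / w ^ 4)) * jacobiTheta₂ (1 / 2) (-1 / w) ^ 8) * this -
    jacobiTheta₂ (1 / 2) (-1 / w) ^ 8 * h4

theorem exists_norm_jacobiTheta₂_half_le :
    ∃ C : ℝ, ∀ w : ℂ, 1 ≤ w.im → ‖jacobiTheta₂ (w / 2) w‖ ≤ C := by
  have hs : Summable fun n : ℤ => Real.exp (-Real.pi * (n ^ 2 + n)) := by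
    refine ((summable_jacobiTheta₂_term_iff (Complex.I / 2) Complex.I).mpr (by simp)).norm.congr
      fun n => ?_
    rw [norm_jacobiTheta₂_term]
    congr 1
    simp
    ring
  refine ⟨∑' n : ℤ, Real.exp (-Real.pi * (n ^ 2 + n)), fun w hw => ?_⟩
  refine tsum_of_norm_bounded hs.hasSum fun n => ?_
  rw [norm_jacobiTheta₂_term]
  gcongr
  -- The norm of the term is `exp (-π y (n ^ 2 + n))` with `y = Im w`, which decreases in `y`.
  have h0 : (0 : ℝ) ≤ (n : ℝ) ^ 2 + n := by
    have : 0 ≤ n ^ 2 + n := by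
      rcases le_or_gt 0 n with h | h <;> nlinarith
    exact_mod_cast this
  have him : (w / 2).im = w.im / 2 := by simp
  rw [him]
  nlinarith [mul_nonneg (mul_nonneg Real.pi_pos.le h0) (sub_nonneg.mpr hw)]

theorem thetaEightDefect_one_sub_one_div {w : ℂ} (hw : 0 < w.im) :
    thetaEightDefect (1 + -1 / w) = w ^ 4 * (eisFour ((w - 1) / 2) - 2 * eisFour w +
      eisFour (w / 2) - 15 * (Complex.exp (2 * Real.pi * Complex.I * w) *
        jacobiTheta₂ (w / 2) w ^ 8)) := by
  have hw0 : w ≠ 0 := by rintro rfl; simp at hw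
  have hw1 : w - 1 ≠ 0 := by
    intro h
    rw [sub_eq_zero.mp h] at hw
    simp at hw
  have hu : 0 < ((1 + -1 / w) / 2).im := by
    have := im_neg_one_div_pos hw
    simp only [Complex.div_ofNat_im, Complex.add_im, Complex.one_im]
    linarith
  have hv : 0 < ((w - 1) / 2).im := by simpa using hw
  -- `(w - 1) / (2 w)` is the image of `(w - 1) / 2` under an element of `SL(2, ℤ)`.
  have h1 : eisFour ((1 + -1 / w) / 2) = w ^ 4 * eisFour ((w - 1) / 2) := by
    have e1 := eisFour_neg_one_div hu
    have e2 : eisFour (-1 / ((1 + -1 / w) / 2)) = eisFour (-1 / ((w - 1) / 2)) := by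
      rw [← eisFour_add_one, ← eisFour_add_one]
      congr 1
      rw [show 1 + -1 / w = (w - 1) / w by field_simp; ring]
      field_simp
      ring
    rw [e2, eisFour_neg_one_div hv] at e1
    have e3 : ((1 + -1 / w) / 2) ^ 4 * w ^ 4 = ((w - 1) / 2) ^ 4 := by
      rw [← mul_pow]
      congr 1
      field_simp
      ring
    apply mul_left_cancel₀ (pow_ne_zero 4 hw1)
    linear_combination (-16 * w ^ 4) * e1 - 16 * eisFour ((1 + -1 / w) / 2) * e3
  have h2 : eisFour (1 + -1 / w) = w ^ 4 * eisFour w := by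
    rw [add_comm, eisFour_add_one, eisFour_neg_one_div hw]
  have h3 : eisFour (2 * (1 + -1 / w)) = w ^ 4 / 16 * eisFour (w / 2) := by
    rw [show 2 * (1 + -1 / w) = -1 / (w / 2) + 1 + 1 by field_simp; ring, eisFour_add_one,
      eisFour_add_one, eisFour_neg_one_div (by simpa using hw)]
    ring
  rw [thetaEightDefect, h1, h2, h3, jacobiTheta_one_sub_one_div_pow_eight hw]
  ring

/-- The transform of `thetaEightDefect` to the cusp of the theta group other than `i∞`. -/
noncomputable def thetaEightDefectCusp (w : ℂ) : ℂ := thetaEightDefect (1 + -1 / w) / w ^ 4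

theorem exists_norm_thetaEightDefectCusp_le :
    ∃ C : ℝ, ∀ w : ℂ, 1 ≤ w.im → ‖thetaEightDefectCusp w‖ ≤ C := by
  obtain ⟨C, hC⟩ := exists_norm_eisFour_le
  obtain ⟨D, hD⟩ := exists_norm_jacobiTheta₂_half_le
  refine ⟨C + 2 * C + C + 15 * (1 * D ^ 8), fun w hw => ?_⟩
  have hw0 : w ≠ 0 := by rintro rfl; simp at hw; linarith
  rw [thetaEightDefectCusp, thetaEightDefect_one_sub_one_div (by linarith),
    mul_div_cancel_left₀ _ (pow_ne_zero 4 hw0)]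
  have h1 := hC ((w - 1) / 2) (by simp; linarith)
  have h2 := hC w (by linarith)
  have h3 := hC (w / 2) (by simp; linarith)
  refine (norm_sub_le _ _).trans (add_le_add ((norm_add_le _ _).trans (add_le_add
    ((norm_sub_le _ _).trans (add_le_add h1 ?_)) h3)) ?_)
  · rw [norm_mul]; simpa using h2
  · rw [norm_mul, norm_mul, norm_pow, norm_exp_two_pi_mul_I_mul]
    simp only [Complex.norm_ofNat]
    gcongr
    · exact Real.exp_le_one_iff.mpr (by nlinarith [Real.pi_pos])
    · exact hD w hw

/-- The norm of `thetaEightDefect` from the theta group to `SL(2, ℤ)` is a modular form of weight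
twelve which vanishes to order two at infinity, so that it is zero; hence so is
`thetaEightDefect`. -/
theorem thetaEightDefect_eq_zero {w : ℂ} (hw : 0 < w.im) : thetaEightDefect w = 0 := by
  let U : Set ℂ := {w | 0 < w.im}
  have hne : ∀ w ∈ U, w ≠ 0 := by
    rintro w hw rfl
    simp [U] at hw
  have hcusp : ∀ w ∈ U, thetaEightDefect (1 + -1 / w) = w ^ 4 * thetaEightDefectCusp w := by
    intro w hw
    rw [thetaEightDefectCusp, mul_div_cancel₀ _ (pow_ne_zero 4 (hne w hw))]
  have hadd : ∀ w ∈ U, w + 1 ∈ U := fun w hw => by simpa [U] using hw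
  have hinv : ∀ w ∈ U, -1 / w ∈ U := fun w hw => im_neg_one_div_pos hw
  have hd0 : DifferentiableOn ℂ thetaEightDefect U := differentiableOn_thetaEightDefect
  have hd1 : DifferentiableOn ℂ (fun w => thetaEightDefect (w + 1)) U :=
    hd0.comp (by fun_prop) hadd
  have hd2 : DifferentiableOn ℂ thetaEightDefectCusp U := by
    have h1 : DifferentiableOn ℂ (fun w : ℂ => 1 + -1 / w) U := fun w hw =>
      ((differentiableAt_const 1).add ((differentiableAt_const (-1)).div differentiableAt_id
        (hne w hw))).differentiableWithinAt
    refine (hd0.comp h1 fun w hw => ?_).div (by fun_prop) fun w hw => pow_ne_zero 4 (hne w hw)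
    have := hinv w hw
    simpa [U] using this
  obtain ⟨C, hC⟩ := exists_norm_thetaEightDefect_le
  obtain ⟨D, hD⟩ := exists_norm_thetaEightDefectCusp_le
  have hprod : ∀ w ∈ U,
      thetaEightDefect w * thetaEightDefect (w + 1) * thetaEightDefectCusp w = 0 := by
    intro w hw
    refine eq_zero_of_weight_twelve_of_decay (C := C * C * D)
      (F := fun w => thetaEightDefect w * thetaEightDefect (w + 1) * thetaEightDefectCusp w)
      ((hd0.mul hd1).mul hd2) ?_ ?_ ?_ hw
    · intro w hw
      have h1 : thetaEightDefect (w + 1 + 1) = thetaEightDefect w := by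
        rw [add_assoc, one_add_one_eq_two, thetaEightDefect_add_two]
      have h2 : thetaEightDefectCusp (w + 1) = thetaEightDefectCusp w := by
        have hw0 := hne w hw
        have hw1 := hne _ (hadd w hw)
        have hv : -1 / w - 1 ∈ U := by
          have := hinv w hw
          simpa [U] using this
        have e := thetaEightDefect_neg_one_div hv
        rw [← thetaEightDefect_add_two (-1 / w - 1), show -1 / w - 1 + 2 = 1 + -1 / w by ring,
          hcusp w hw,
          show -1 / (-1 / w - 1) = 1 + -1 / (w + 1) by
            have h3 : -1 / w - 1 ≠ 0 := hne _ hv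
            have h4 : -1 / w - 1 = -(w + 1) / w := by field_simp; ring
            rw [h4]; field_simp; ring, hcusp _ (hadd w hw),
          show -1 / w - 1 = -(w + 1) / w by field_simp; ring] at e
        have : (w + 1) ^ 4 ≠ 0 := pow_ne_zero 4 hw1
        apply mul_left_cancel₀ this
        rw [e]
        field_simp
      simp only [h1, h2]
      ring
    · intro w hw
      have hw0 := hne w hw
      have h1 : thetaEightDefect (-1 / w + 1) = w ^ 4 * thetaEightDefectCusp w := by
        rw [add_comm, hcusp w hw]
      have h2 : thetaEightDefectCusp (-1 / w) = w ^ 4 * thetaEightDefect (w + 1) := by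
        rw [thetaEightDefectCusp, show 1 + -1 / (-1 / w) = w + 1 by field_simp; ring]
        field_simp
      simp only [thetaEightDefect_neg_one_div hw, h1, h2]
      ring
    · intro w hw
      have h1 := hC w hw
      have h2 := hC (w + 1) (by simpa using hw)
      rw [show (w + 1).im = w.im by simp] at h2
      rw [norm_mul, norm_mul]
      calc _ ≤ (C * Real.exp (-2 * Real.pi * w.im)) * (C * Real.exp (-2 * Real.pi * w.im)) * D := by
            have h3 := (norm_nonneg _).trans h1
            gcongr
            exact hD w hw
        _ = C * C * D * (Real.exp (-2 * Real.pi * w.im) * Real.exp (-2 * Real.pi * w.im)) := by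
            ring
        _ = _ := by rw [← Real.exp_add]; ring_nf
  have hU : IsOpen U := UpperHalfPlane.isOpen_upperHalfPlaneSet
  have hpre : IsPreconnected U := (convex_halfSpace_im_gt 0).isPreconnected
  -- A product of holomorphic functions vanishes on a connected open set only if a factor does.
  rcases AnalyticOnNhd.eq_zero_or_eq_zero_of_mul_eq_zero ((hd0.mul hd1).analyticOnNhd hU)
    (hd2.analyticOnNhd hU) hprod hpre with h | h
  · rcases AnalyticOnNhd.eq_zero_or_eq_zero_of_mul_eq_zero (hd0.analyticOnNhd hU)
      (hd1.analyticOnNhd hU) h hpre with h | h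
    · exact h w hw
    · simpa using h (w - 1) (by simpa [U] using hw)
  · have hv : -1 / (w - 1) ∈ U := hinv _ (by simpa [U] using hw)
    have e := hcusp _ hv
    have hw1 : w - 1 ≠ 0 := hne _ (by simpa [U] using hw)
    rw [h _ hv, mul_zero, show 1 + -1 / (-1 / (w - 1)) = w by field_simp; ring] at e
    exact e

open UpperHalfPlane in
/-- The eight squares theorem in terms of the divisor function. Since `exp (π i w)` is the parameter
of period two, uniqueness of coefficients is obtained by comparison with the zero modular form, seen
as a function of period two. -/
theorem thetaEightDefectCoeff_eq_zero (n : ℕ) : thetaEightDefectCoeff n = 0 := by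
  have hf : ∀ τ : ℍ, HasSum (fun m => thetaEightDefectCoeff m • Function.Periodic.qParam 2 τ ^ m)
      ((0 : ModularForm (Matrix.SpecialLinearGroup.mapGL ℝ :
        Matrix.SpecialLinearGroup (Fin 2) ℤ →* GL (Fin 2) ℝ).range 4) τ) := by
    intro τ
    have := hasSum_thetaEightDefect τ.im_pos
    rw [thetaEightDefect_eq_zero τ.im_pos] at this
    refine this.congr_fun fun m => ?_
    rw [smul_eq_mul, Function.Periodic.qParam]
    congr 3
    push_cast
    ring
  have h2 : (2 : ℝ) ∈ (Matrix.SpecialLinearGroup.mapGL ℝ :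
      Matrix.SpecialLinearGroup (Fin 2) ℤ →* GL (Fin 2) ℝ).range.strictPeriods := by
    have := AddSubgroup.nsmul_mem _ one_mem_strictPeriods_SL 2
    simpa using this
  rw [ModularFormClass.qExpansion_coeff_unique two_pos h2 hf n, FunLike.coe_zero, qExpansion_zero,
    map_zero]

/-! ### The eight squares theorem -/

theorem filter_even_divisors_two_mul (m : ℕ) :
    (2 * m).divisors.filter Even =
      m.divisors.map ⟨fun d => 2 * d, mul_right_injective₀ two_ne_zero⟩ := by
  ext d
  simp only [Finset.mem_filter, Nat.mem_divisors, Finset.mem_map, Function.Embedding.coeFn_mk]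
  constructor
  · rintro ⟨⟨h1, h2⟩, h3⟩
    obtain ⟨e, rfl⟩ := even_iff_two_dvd.mp h3
    exact ⟨e, ⟨Nat.dvd_of_mul_dvd_mul_left two_pos h1, by omega⟩, rfl⟩
  · rintro ⟨e, ⟨h1, h2⟩, rfl⟩
    exact ⟨⟨mul_dvd_mul_left 2 h1, by omega⟩, even_two_mul e⟩

theorem filter_odd_divisors_two_mul (m : ℕ) :
    (2 * m).divisors.filter (fun d => ¬Even d) = m.divisors.filter fun d => ¬Even d := by
  ext d
  simp only [Finset.mem_filter, Nat.mem_divisors, Nat.not_even_iff_odd]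
  constructor
  · rintro ⟨⟨h1, h2⟩, h3⟩
    exact ⟨⟨(Nat.coprime_two_right.mpr h3).dvd_of_dvd_mul_left h1, by omega⟩, h3⟩
  · rintro ⟨⟨h1, h2⟩, h3⟩
    exact ⟨⟨h1.mul_left 2, by omega⟩, h3⟩

/-- Even divisors of `2 * m` are the doubles of the divisors of `m`, and the odd ones are the odd
divisors of `m`. -/
theorem sum_divisors_two_mul (f : ℕ → ℤ) (m : ℕ) :
    ∑ d ∈ (2 * m).divisors, f d =
      ∑ d ∈ m.divisors, f (2 * d) + ∑ d ∈ m.divisors with ¬Even d, f d := by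
  rw [← Finset.sum_filter_add_sum_filter_not _ Even, filter_even_divisors_two_mul,
    filter_odd_divisors_two_mul, Finset.sum_map]
  rfl

theorem sigma_three_eq_sum (n : ℕ) :
    (ArithmeticFunction.sigma 3 n : ℤ) = ∑ d ∈ n.divisors, (d : ℤ) ^ 3 := by
  rw [ArithmeticFunction.sigma_apply]
  push_cast
  rfl

theorem sigma_three_two_mul (m : ℕ) :
    (ArithmeticFunction.sigma 3 (2 * m) : ℤ) =
      8 * ArithmeticFunction.sigma 3 m + ∑ d ∈ m.divisors with ¬Even d, (d : ℤ) ^ 3 := by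
  rw [sigma_three_eq_sum, sigma_three_eq_sum, sum_divisors_two_mul, Finset.mul_sum]
  congr 1
  refine Finset.sum_congr rfl fun d _ => ?_
  push_cast
  ring

/-- For an even number, the signed sum is twice the sum over the even divisors minus the full
sum. -/
theorem sum_divisors_two_mul_neg_one_pow_mul_cube (m : ℕ) :
    ∑ d ∈ (2 * m).divisors, (-1 : ℤ) ^ d * (d : ℤ) ^ 3 =
      16 * (ArithmeticFunction.sigma 3 m : ℤ) - ArithmeticFunction.sigma 3 (2 * m) := by
  rw [sigma_three_two_mul, sum_divisors_two_mul]
  have h1 : ∑ d ∈ m.divisors, (-1 : ℤ) ^ (2 * d) * ((2 * d : ℕ) : ℤ) ^ 3 =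
      8 * (ArithmeticFunction.sigma 3 m : ℤ) := by
    rw [sigma_three_eq_sum, Finset.mul_sum]
    refine Finset.sum_congr rfl fun d _ => ?_
    rw [(even_two_mul d).neg_one_pow]
    push_cast
    ring
  have h2 : ∑ d ∈ m.divisors with ¬Even d, (-1 : ℤ) ^ d * (d : ℤ) ^ 3 =
      -∑ d ∈ m.divisors with ¬Even d, (d : ℤ) ^ 3 := by
    rw [← Finset.sum_neg_distrib]
    refine Finset.sum_congr rfl fun d hd => ?_
    rw [(Nat.not_even_iff_odd.mp (Finset.mem_filter.mp hd).2).neg_one_pow]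
    ring
  rw [h1, h2]
  ring

theorem not_even_of_mem_divisors_of_odd {n d : ℕ} (hn : Odd n) (hd : d ∈ n.divisors) : ¬Even d :=
  Nat.not_even_iff_odd.mpr (hn.of_dvd_nat (Nat.dvd_of_mem_divisors hd))

/-- **Jacobi's eight squares theorem**. -/
theorem neg_one_pow_mul_sumSqCount_eight {n : ℕ} (hn : 1 ≤ n) :
    (-1 : ℤ) ^ n * (sumSqCount 8 n : ℤ) =
      16 * ∑ d ∈ n.divisors, (-1 : ℤ) ^ d * (d : ℤ) ^ 3 := by
  have hc := thetaEightDefectCoeff_eq_zero n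
  rw [thetaEightDefectCoeff, eisFourCoeff, if_neg (by omega)] at hc
  rcases Nat.even_or_odd n with he | ho
  · obtain ⟨m, rfl⟩ := even_iff_two_dvd.mp he
    rw [if_pos (dvd_mul_right 2 m), Nat.mul_div_cancel_left m two_pos, eisFourCoeff,
      if_neg (by omega)] at hc
    rw [he.neg_one_pow, sum_divisors_two_mul_neg_one_pow_mul_cube, one_mul]
    rcases Nat.even_or_odd m with he' | ho'
    · obtain ⟨k, rfl⟩ := even_iff_two_dvd.mp he'
      rw [if_pos ⟨k, by ring⟩, show 2 * (2 * k) / 4 = k by omega, eisFourCoeff,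
        if_neg (by omega)] at hc
      -- Eliminating the odd divisors gives `σ₃ (4 k) = 9 σ₃ (2 k) - 8 σ₃ k`.
      have h1 := sigma_three_two_mul (2 * k)
      have h2 := sigma_three_two_mul k
      rw [filter_odd_divisors_two_mul] at h1
      have hc' : 240 * (ArithmeticFunction.sigma 3 (2 * (2 * k)) : ℤ) -
          2 * (240 * ArithmeticFunction.sigma 3 (2 * k)) +
          16 * (240 * ArithmeticFunction.sigma 3 k) - 15 * sumSqCount 8 (2 * (2 * k)) = 0 := by
        exact_mod_cast hc
      linarith
    · rw [if_neg (by
        rintro ⟨k, hk⟩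
        obtain ⟨j, rfl⟩ := ho'
        omega)] at hc
      have h1 := sigma_three_two_mul m
      rw [Finset.filter_true_of_mem fun d hd => not_even_of_mem_divisors_of_odd ho' hd,
        ← sigma_three_eq_sum] at h1
      have hc' : 240 * (ArithmeticFunction.sigma 3 (2 * m) : ℤ) -
          2 * (240 * ArithmeticFunction.sigma 3 m) + 16 * 0 - 15 * sumSqCount 8 (2 * m) = 0 := by
        exact_mod_cast hc
      linarith
  · have h2 : ¬ 2 ∣ n := by rw [← even_iff_two_dvd]; exact Nat.not_even_iff_odd.mpr ho
    rw [if_neg h2, if_neg (fun h => h2 ((by norm_num : 2 ∣ 4).trans h))] at hc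
    have hc' : 240 * (ArithmeticFunction.sigma 3 n : ℤ) - 2 * 0 + 16 * 0 -
        15 * sumSqCount 8 n = 0 := by
      exact_mod_cast hc
    have h1 : ∑ d ∈ n.divisors, (-1 : ℤ) ^ d * (d : ℤ) ^ 3 =
        -(ArithmeticFunction.sigma 3 n : ℤ) := by
      rw [sigma_three_eq_sum, ← Finset.sum_neg_distrib]
      refine Finset.sum_congr rfl fun d hd => ?_
      rw [(Nat.not_even_iff_odd.mp (not_even_of_mem_divisors_of_odd ho hd)).neg_one_pow]
      ring
    rw [ho.neg_one_pow, h1]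
    linarith

/-! ### Lambert series as double series of logarithms -/

/-- The terms of the triple series over `m`, `d` and `k` that gives rise to the Lambert series on
summation over `k` first, and to a series of logarithms on summation over `m` first. -/
noncomputable def lambertTerm (x Q s : ℂ) (p : (ℕ+ × ℕ+) × ℕ) : ℂ :=
  (-1) ^ (p.1.2 : ℕ) * (p.1.2 : ℂ) ^ 2 *
    ((x ^ (p.1.2 : ℕ) * (Q ^ (p.1.2 : ℕ)) ^ p.2) ^ (p.1.1 : ℕ) / (p.1.1 : ℂ)) * s ^ p.2

section Lambert

variable {x Q s : ℂ}

theorem summable_lambertTerm (hx : ‖x‖ < 1) (hQ : ‖Q‖ < 1) (hs : ‖s‖ ≤ 1) :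
    Summable (lambertTerm x Q s) := by
  have h1 := summable_prod_mul_pow (𝕜 := ℝ) 2 (r := ‖x‖) (by simpa using hx)
  have h2 := summable_geometric_of_lt_one (norm_nonneg Q) hQ
  have h3 := h1.mul_of_nonneg h2 (fun p => by positivity) (fun k => by positivity)
  refine h3.of_norm_bounded fun ⟨⟨m, d⟩, k⟩ => ?_
  have hm : 1 ≤ (m : ℝ) := by exact_mod_cast m.pos
  have hdm : k ≤ d * k * m := by
    calc k = 1 * k * 1 := by ring
      _ ≤ d * k * m := Nat.mul_le_mul (Nat.mul_le_mul_right k d.pos) m.pos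
  have e1 : ‖x‖ ^ ((d : ℕ) * m) = ‖x‖ ^ ((m : ℕ) * d) := by rw [mul_comm]
  simp only [lambertTerm, norm_mul, norm_div, norm_pow, norm_neg, norm_one, one_pow, one_mul,
    Complex.norm_natCast, mul_pow, ← pow_mul, e1]
  have e2 : ‖Q‖ ^ ((d : ℕ) * k * m) ≤ ‖Q‖ ^ k := pow_le_pow_of_le_one (norm_nonneg _) hQ.le hdm
  calc (d : ℝ) ^ 2 * (‖x‖ ^ ((m : ℕ) * d) * ‖Q‖ ^ ((d : ℕ) * k * m) / m) * ‖s‖ ^ k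
      ≤ (d : ℝ) ^ 2 * (‖x‖ ^ ((m : ℕ) * d) * ‖Q‖ ^ k / 1) * 1 := by
        gcongr
        exact pow_le_one₀ (norm_nonneg _) hs
    _ = _ := by ring

theorem hasSum_lambert (hx : ‖x‖ < 1) (hQ : ‖Q‖ < 1) (hs : ‖s‖ ≤ 1) :
    HasSum (fun n : ℕ+ => 1 / (n : ℂ) * (x ^ (n : ℕ) / (1 - s * Q ^ (n : ℕ))) *
      ∑ d ∈ (n : ℕ).divisors, (-1) ^ d * (d : ℂ) ^ 3) (∑' p, lambertTerm x Q s p) := by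
  have h := (summable_lambertTerm hx hQ hs).hasSum
  have h1 : HasSum (fun p : ℕ+ × ℕ+ => (-1) ^ (p.2 : ℕ) * (p.2 : ℂ) ^ 2 *
      (x ^ ((p.1 : ℕ) * p.2) / (p.1 : ℂ)) * (1 - s * Q ^ ((p.1 : ℕ) * p.2))⁻¹)
      (∑' p, lambertTerm x Q s p) := by
    refine h.prod_fiberwise fun p => ?_
    have hq : ‖s * Q ^ ((p.1 : ℕ) * p.2)‖ < 1 := by
      rw [norm_mul, norm_pow]
      have := pow_lt_one₀ (norm_nonneg Q) hQ (mul_ne_zero p.1.ne_zero p.2.ne_zero)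
      nlinarith [norm_nonneg s, norm_nonneg Q, pow_nonneg (norm_nonneg Q) ((p.1 : ℕ) * p.2)]
    refine ((hasSum_geometric_of_norm_lt_one hq).mul_left _).congr_fun fun k => ?_
    simp only [lambertTerm]
    ring
  rw [← sigmaAntidiagonalEquivProd.hasSum_iff] at h1
  refine h1.sigma fun n => ?_
  have hterm : ∀ d ∈ (n : ℕ).divisors, (-1) ^ d * (d : ℂ) ^ 2 *
      (x ^ (n : ℕ) / ((n / d : ℕ) : ℂ)) * (1 - s * Q ^ (n : ℕ))⁻¹ =
      1 / (n : ℂ) * (x ^ (n : ℕ) / (1 - s * Q ^ (n : ℕ))) * ((-1) ^ d * (d : ℂ) ^ 3) := by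
    intro d hd
    have hd0 : (d : ℂ) ≠ 0 := by
      exact_mod_cast (Nat.pos_of_mem_divisors hd).ne'
    have hn0 : (n : ℂ) ≠ 0 := by exact_mod_cast n.ne_zero
    rw [Nat.cast_div (Nat.dvd_of_mem_divisors hd) hd0]
    field_simp
  rw [Finset.mul_sum, ← Finset.sum_congr rfl hterm]
  have e := Nat.sum_divisorsAntidiagonal' (n := n) (fun m d => (-1) ^ d * (d : ℂ) ^ 2 *
      (x ^ (n : ℕ) / (m : ℂ)) * (1 - s * Q ^ (n : ℕ))⁻¹)
  rw [← e]
  refine (Finset.hasSum (n : ℕ).divisorsAntidiagonal _).congr_fun fun p => ?_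
  have hp := (Nat.mem_divisorsAntidiagonal.mp p.2).1
  simp [sigmaAntidiagonalEquivProd, divisorsAntidiagonalFactors, hp]

theorem norm_pow_mul_pow_lt_one (hx : ‖x‖ < 1) (hQ : ‖Q‖ < 1) {d : ℕ} (hd : d ≠ 0) (k : ℕ) :
    ‖x ^ d * (Q ^ d) ^ k‖ < 1 := by
  rw [norm_mul, norm_pow, norm_pow, norm_pow]
  have h1 := pow_lt_one₀ (norm_nonneg x) hx hd
  have h2 := pow_le_one₀ (n := k) (pow_nonneg (norm_nonneg Q) d)
    (pow_le_one₀ (norm_nonneg Q) hQ.le)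
  nlinarith [pow_nonneg (norm_nonneg x) d]

theorem hasSum_log_lambert (hx : ‖x‖ < 1) (hQ : ‖Q‖ < 1) (hs : ‖s‖ ≤ 1) :
    HasSum (fun d : ℕ+ => (-1) ^ (d : ℕ) * (d : ℂ) ^ 2 *
      ∑' k : ℕ, s ^ k * -Complex.log (1 - x ^ (d : ℕ) * (Q ^ (d : ℕ)) ^ k))
      (∑' p, lambertTerm x Q s p) := by
  let e : (ℕ+ × ℕ) × ℕ+ ≃ (ℕ+ × ℕ+) × ℕ :=
    ⟨fun p => ((p.2, p.1.1), p.1.2), fun p => ((p.1.2, p.2), p.1.1), fun _ => rfl, fun _ => rfl⟩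
  have h := (summable_lambertTerm hx hQ hs).hasSum
  rw [← e.hasSum_iff] at h
  have h1 : HasSum (fun p : ℕ+ × ℕ => (-1) ^ (p.1 : ℕ) * (p.1 : ℂ) ^ 2 *
      (s ^ p.2 * -Complex.log (1 - x ^ (p.1 : ℕ) * (Q ^ (p.1 : ℕ)) ^ p.2)))
      (∑' p, lambertTerm x Q s p) := by
    refine h.prod_fiberwise fun p => ?_
    have hlog := Complex.hasSum_taylorSeries_neg_log
      (norm_pow_mul_pow_lt_one hx hQ p.1.ne_zero p.2)
    have hlog' := (hasSum_pnat_iff (f := fun n : ℕ =>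
      (x ^ (p.1 : ℕ) * (Q ^ (p.1 : ℕ)) ^ p.2) ^ n / (n : ℂ))).mpr (by simpa using hlog)
    refine ((hlog'.mul_left (s ^ p.2)).mul_left _).congr_fun fun m => ?_
    simp only [lambertTerm, e, Function.comp_apply, Equiv.coe_fn_mk]
    ring
  refine h1.prod_fiberwise fun d => ?_
  have hsum := h1.summable.prod_factor d
  rw [← tsum_mul_left]
  exact hsum.hasSum

end Lambert

/-! ### Exponentials of the logarithmic series -/

theorem exists_hasSum_log_qPochInf {a p : ℂ} (ha : ‖a‖ < 1) (hp : ‖p‖ < 1) :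
    ∃ M, HasSum (fun k : ℕ => Complex.log (1 - a * p ^ k)) M ∧ Complex.exp M = qPochInf a p := by
  have hs : Summable fun k : ℕ => Complex.log (1 + -(a * p ^ k)) :=
    Complex.summable_log_one_add_of_summable
      (((summable_geometric_of_norm_lt_one hp).mul_left a).neg)
  simp only [← sub_eq_add_neg] at hs
  refine ⟨_, hs.hasSum, ?_⟩
  have h := hs.hasSum.cexp
  refine h.unique ((hasProd_qPochInf a hp).congr_fun fun k => ?_)
  rw [Function.comp_apply, Complex.exp_log]
  intro h0
  have h1 : ‖a * p ^ k‖ < 1 := by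
    rw [norm_mul, norm_pow]
    have := pow_le_one₀ (n := k) (norm_nonneg p) hp.le
    nlinarith [norm_nonneg a]
  rw [← sub_eq_zero.mp h0, norm_one] at h1
  exact lt_irrefl _ h1

theorem exp_tsum_neg_log {a p : ℂ} (ha : ‖a‖ < 1) (hp : ‖p‖ < 1) :
    Complex.exp (∑' k : ℕ, (1 : ℂ) ^ k * -Complex.log (1 - a * p ^ k)) = (qPochInf a p)⁻¹ := by
  obtain ⟨M, hM, he⟩ := exists_hasSum_log_qPochInf ha hp
  simp only [one_pow, one_mul, tsum_neg, hM.tsum_eq, Complex.exp_neg, he]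

/-- The terms with even and with odd index make up one factorial each, to the base `p ^ 2`. -/
theorem exp_tsum_neg_one_pow_mul_neg_log {a p : ℂ} (ha : ‖a‖ < 1) (hp : ‖p‖ < 1) :
    Complex.exp (∑' k : ℕ, (-1 : ℂ) ^ k * -Complex.log (1 - a * p ^ k)) =
      qPochInf (a * p) (p ^ 2) / qPochInf a (p ^ 2) := by
  have hp2 : ‖p ^ 2‖ < 1 := by
    rw [norm_pow]
    exact pow_lt_one₀ (norm_nonneg p) hp two_ne_zero
  have hap : ‖a * p‖ < 1 := by
    rw [norm_mul]
    nlinarith [norm_nonneg a, norm_nonneg p]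
  obtain ⟨M, hM, hMe⟩ := exists_hasSum_log_qPochInf ha hp2
  obtain ⟨N, hN, hNe⟩ := exists_hasSum_log_qPochInf hap hp2
  have h : HasSum (fun k : ℕ => (-1 : ℂ) ^ k * -Complex.log (1 - a * p ^ k)) (-M + N) := by
    refine HasSum.even_add_odd (hM.neg.congr_fun fun k => ?_) (hN.congr_fun fun k => ?_)
    · rw [(even_two_mul k).neg_one_pow, one_mul, pow_mul]
    · rw [(odd_two_mul_add_one k).neg_one_pow, pow_succ, pow_mul, neg_one_mul, neg_neg, mul_assoc,
        mul_comm p]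
  rw [h.tsum_eq, Complex.exp_add, Complex.exp_neg, hMe, hNe]
  ring

/-- A product over the positive integers whose factors are exponentials may be taken over pairs of
consecutive integers. -/
theorem HasSum.hasProd_exp_pairs {l : ℕ → ℂ} {S : ℂ} (h : HasSum (fun d : ℕ+ => l d) S) :
    HasProd (fun n : ℕ+ => Complex.exp (l (2 * n - 1)) * Complex.exp (l (2 * n)))
      (Complex.exp S) := by
  have h1 : HasSum (fun k : ℕ => l (k + 1)) S := Equiv.pnatEquivNat.symm.hasSum_iff.mpr h
  have ha := (h1.summable.comp_injective (i := fun k : ℕ => 2 * k)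
    fun a b hab => by simpa using hab).hasSum
  have hb := (h1.summable.comp_injective (i := fun k : ℕ => 2 * k + 1)
    fun a b hab => by simpa using hab).hasSum
  have hS := (HasSum.even_add_odd (f := fun k : ℕ => l (k + 1)) ha hb).unique h1
  have h2 : HasSum (fun n : ℕ+ => l (2 * n - 1) + l (2 * n)) S := by
    rw [← Equiv.pnatEquivNat.symm.hasSum_iff, ← hS]
    refine (ha.add hb).congr_fun fun k => ?_
    simp only [Function.comp_apply, Equiv.pnatEquivNat_symm_apply, Nat.succPNat_coe]
    congr 2
  refine h2.cexp.congr_fun fun n => ?_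
  rw [Function.comp_apply, Complex.exp_add]

theorem exp_even_mul {d : ℕ} (hd : Even d) (T : ℂ) :
    Complex.exp ((-1) ^ d * (d : ℂ) ^ 2 * T) = Complex.exp T ^ d ^ 2 := by
  rw [hd.neg_one_pow, one_mul, ← Complex.exp_nat_mul]
  push_cast
  rfl

theorem exp_odd_mul {d : ℕ} (hd : Odd d) (T : ℂ) :
    Complex.exp ((-1) ^ d * (d : ℂ) ^ 2 * T) = (Complex.exp T ^ d ^ 2)⁻¹ := by
  rw [hd.neg_one_pow, ← Complex.exp_nat_mul, ← Complex.exp_neg]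
  push_cast
  ring_nf

/-- The series in the exponent, in the form given by the eight squares theorem. -/
theorem hasSum_sumSqCount_lambert {x Q s : ℂ} (hx : ‖x‖ < 1) (hQ : ‖Q‖ < 1) (hs : ‖s‖ ≤ 1) :
    HasSum (fun n : ℕ+ => (sumSqCount 8 n : ℂ) / (16 * (n : ℂ)) *
      ((-1 : ℂ) ^ (n : ℕ) * x ^ (n : ℕ) / (1 - s * Q ^ (n : ℕ))))
      (∑' p, lambertTerm x Q s p) := by
  refine (hasSum_lambert hx hQ hs).congr_fun fun n => ?_
  have h := neg_one_pow_mul_sumSqCount_eight n.pos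
  have h' : (-1 : ℂ) ^ (n : ℕ) * (sumSqCount 8 n : ℂ) =
      16 * ∑ d ∈ (n : ℕ).divisors, (-1 : ℂ) ^ d * (d : ℂ) ^ 3 := by
    exact_mod_cast congrArg (Int.cast : ℤ → ℂ) h
  have hn0 : (n : ℂ) ≠ 0 := by exact_mod_cast n.ne_zero
  have h2 : ∑ d ∈ (n : ℕ).divisors, (-1 : ℂ) ^ d * (d : ℂ) ^ 3 =
      (-1 : ℂ) ^ (n : ℕ) * (sumSqCount 8 n : ℂ) / 16 := by
    rw [h']
    ring
  rw [h2]
  field_simp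

section Products

variable {x Q : ℂ}

theorem hasProd_qPochInf_pow (hx : ‖x‖ < 1) (hQ : ‖Q‖ < 1) :
    HasProd (fun n : ℕ+ =>
      qPochInf (x ^ (2 * (n : ℕ) - 1)) (Q ^ (2 * (n : ℕ) - 1)) ^ ((2 * (n : ℕ) - 1) ^ 2) /
        qPochInf (x ^ (2 * (n : ℕ))) (Q ^ (2 * (n : ℕ))) ^ (4 * (n : ℕ) ^ 2))
      (Complex.exp (∑' p, lambertTerm x Q 1 p)) := by
  have h := HasSum.hasProd_exp_pairs
    (l := fun d : ℕ => (-1) ^ d * (d : ℂ) ^ 2 *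
      ∑' k : ℕ, 1 ^ k * -Complex.log (1 - x ^ d * (Q ^ d) ^ k))
    (hasSum_log_lambert hx hQ (norm_one (α := ℂ)).le)
  refine h.congr_fun fun n => ?_
  have hn := n.pos
  have ho : 2 * (n : ℕ) - 1 ≠ 0 := by omega
  have he : 2 * (n : ℕ) ≠ 0 := by omega
  have hlt : ∀ {y : ℂ}, ‖y‖ < 1 → ∀ {d : ℕ}, d ≠ 0 → ‖y ^ d‖ < 1 := fun hy d hd => by
    rw [norm_pow]
    exact pow_lt_one₀ (norm_nonneg _) hy hd
  rw [exp_odd_mul ⟨n - 1, by omega⟩, exp_even_mul (even_two_mul _),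
    exp_tsum_neg_log (hlt hx ho) (hlt hQ ho), exp_tsum_neg_log (hlt hx he) (hlt hQ he),
    inv_pow, inv_inv, inv_pow, div_eq_mul_inv,
    show (2 * (n : ℕ)) ^ 2 = 4 * (n : ℕ) ^ 2 by ring]

theorem hasProd_qPochInf_sq_pow (hx : ‖x‖ < 1) (hQ : ‖Q‖ < 1) :
    HasProd (fun n : ℕ+ =>
      (qPochInf ((x * Q) ^ (2 * (n : ℕ))) (Q ^ (4 * (n : ℕ))) ^ (4 * (n : ℕ) ^ 2) *
          qPochInf (x ^ (2 * (n : ℕ) - 1)) (Q ^ (4 * (n : ℕ) - 2)) ^ ((2 * (n : ℕ) - 1) ^ 2)) /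
        (qPochInf (x ^ (2 * (n : ℕ))) (Q ^ (4 * (n : ℕ))) ^ (4 * (n : ℕ) ^ 2) *
          qPochInf ((x * Q) ^ (2 * (n : ℕ) - 1)) (Q ^ (4 * (n : ℕ) - 2)) ^
            ((2 * (n : ℕ) - 1) ^ 2)))
      (Complex.exp (∑' p, lambertTerm x Q (-1) p)) := by
  have h := HasSum.hasProd_exp_pairs
    (l := fun d : ℕ => (-1) ^ d * (d : ℂ) ^ 2 *
      ∑' k : ℕ, (-1) ^ k * -Complex.log (1 - x ^ d * (Q ^ d) ^ k))
    (hasSum_log_lambert hx hQ (by simp))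
  refine h.congr_fun fun n => ?_
  have hn := n.pos
  have ho : 2 * (n : ℕ) - 1 ≠ 0 := by omega
  have he : 2 * (n : ℕ) ≠ 0 := by omega
  have hlt : ∀ {y : ℂ}, ‖y‖ < 1 → ∀ {d : ℕ}, d ≠ 0 → ‖y ^ d‖ < 1 := fun hy d hd => by
    rw [norm_pow]
    exact pow_lt_one₀ (norm_nonneg _) hy hd
  rw [exp_odd_mul ⟨n - 1, by omega⟩, exp_even_mul (even_two_mul _),
    exp_tsum_neg_one_pow_mul_neg_log (hlt hx ho) (hlt hQ ho),
    exp_tsum_neg_one_pow_mul_neg_log (hlt hx he) (hlt hQ he),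
    ← mul_pow x Q, ← mul_pow x Q, ← pow_mul Q, ← pow_mul Q,
    show (2 * (n : ℕ) - 1) * 2 = 4 * (n : ℕ) - 2 by omega,
    show 2 * (n : ℕ) * 2 = 4 * (n : ℕ) by omega,
    show (2 * (n : ℕ)) ^ 2 = 4 * (n : ℕ) ^ 2 by ring, div_pow, div_pow, inv_div,
    div_mul_div_comm]
  congr 1 <;> ring

end Products

theorem mainTheorem7 :
    (∀ n : ℕ, 1 ≤ n →
      (-1 : ℤ) ^ n * (sumSqCount 8 n : ℤ) =
        16 * ∑ d ∈ n.divisors, (-1 : ℤ) ^ d * (d : ℤ) ^ 3) ∧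
    ∀ (q : ℝ) (z : ℂ), 0 < q → q < 1 → 0 < z.re →
      (Summable (fun n : ℕ+ =>
          (sumSqCount 8 n : ℂ) / (16 * (n : ℂ)) *
            ((-1 : ℂ) ^ (n : ℕ) * (q : ℂ) ^ ((n : ℂ) * z) / (1 - (q : ℂ) ^ (n : ℕ)))) ∧
        HasProd (fun n : ℕ+ =>
          qPochInf ((q : ℂ) ^ ((2 * (n : ℂ) - 1) * z)) ((q : ℂ) ^ (2 * (n : ℕ) - 1))
              ^ ((2 * (n : ℕ) - 1) ^ 2) /
            qPochInf ((q : ℂ) ^ (2 * (n : ℂ) * z)) ((q : ℂ) ^ (2 * (n : ℕ)))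
              ^ (4 * (n : ℕ) ^ 2))
          (Complex.exp (∑' n : ℕ+,
            (sumSqCount 8 n : ℂ) / (16 * (n : ℂ)) *
              ((-1 : ℂ) ^ (n : ℕ) * (q : ℂ) ^ ((n : ℂ) * z) / (1 - (q : ℂ) ^ (n : ℕ)))))) ∧
      (Summable (fun n : ℕ+ =>
          (sumSqCount 8 n : ℂ) / (16 * (n : ℂ)) *
            ((-1 : ℂ) ^ (n : ℕ) * (q : ℂ) ^ ((n : ℂ) * z) / (1 + (q : ℂ) ^ (n : ℕ)))) ∧
        HasProd (fun n : ℕ+ =>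
          (qPochInf ((q : ℂ) ^ (2 * (n : ℂ) * (z + 1))) ((q : ℂ) ^ (4 * (n : ℕ)))
                ^ (4 * (n : ℕ) ^ 2) *
              qPochInf ((q : ℂ) ^ ((2 * (n : ℂ) - 1) * z)) ((q : ℂ) ^ (4 * (n : ℕ) - 2))
                ^ ((2 * (n : ℕ) - 1) ^ 2)) /
            (qPochInf ((q : ℂ) ^ (2 * (n : ℂ) * z)) ((q : ℂ) ^ (4 * (n : ℕ)))
                ^ (4 * (n : ℕ) ^ 2) *
              qPochInf ((q : ℂ) ^ ((2 * (n : ℂ) - 1) * (z + 1))) ((q : ℂ) ^ (4 * (n : ℕ) - 2))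
                ^ ((2 * (n : ℕ) - 1) ^ 2)))
          (Complex.exp (∑' n : ℕ+,
            (sumSqCount 8 n : ℂ) / (16 * (n : ℂ)) *
              ((-1 : ℂ) ^ (n : ℕ) * (q : ℂ) ^ ((n : ℂ) * z) / (1 + (q : ℂ) ^ (n : ℕ)))))) := by
  refine ⟨fun n hn => neg_one_pow_mul_sumSqCount_eight hn, fun q z hq0 hq1 hz => ?_⟩
  have hx : ‖(q : ℂ) ^ z‖ < 1 := by
    rw [Complex.norm_cpow_eq_rpow_re_of_pos hq0]
    exact Real.rpow_lt_one hq0.le hq1 hz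
  have hQ : ‖(q : ℂ)‖ < 1 := by
    rw [Complex.norm_real, Real.norm_of_nonneg hq0.le]
    exact hq1
  have hq : (q : ℂ) ≠ 0 := by exact_mod_cast hq0.ne'
  have c0 : ∀ (n : ℕ) (w : ℂ), (q : ℂ) ^ ((n : ℂ) * w) = ((q : ℂ) ^ w) ^ n := fun n w =>
    Complex.cpow_nat_mul _ n w
  have c1 : ∀ (n : ℕ+) (w : ℂ), (q : ℂ) ^ ((2 * (n : ℂ) - 1) * w) =
      ((q : ℂ) ^ w) ^ (2 * (n : ℕ) - 1) := by
    intro n w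
    rw [← c0, Nat.cast_sub (by have := n.pos; omega)]
    push_cast
    rfl
  have c2 : ∀ (n : ℕ+) (w : ℂ), (q : ℂ) ^ (2 * (n : ℂ) * w) = ((q : ℂ) ^ w) ^ (2 * (n : ℕ)) := by
    intro n w
    rw [← c0]
    push_cast
    rfl
  have c3 : (q : ℂ) ^ (z + 1) = (q : ℂ) ^ z * q := by rw [Complex.cpow_add _ _ hq, Complex.cpow_one]
  have h1 := hasSum_sumSqCount_lambert (s := 1) hx hQ (by simp)
  have h2 := hasSum_sumSqCount_lambert (s := -1) hx hQ (by simp)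
  simp only [one_mul, neg_one_mul, sub_neg_eq_add] at h1 h2
  simp only [c0, c1, c2, c3]
  refine ⟨⟨h1.summable, ?_⟩, h2.summable, ?_⟩
  · rw [h1.tsum_eq]
    exact hasProd_qPochInf_pow hx hQ
  · rw [h2.tsum_eq]
    exact hasProd_qPochInf_sq_pow hx hQ
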